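/- Let $\Sigma$ be a finite nonempty alphabet, and let $\mathrm{Pr}$ be the uniform probability measure on $\Sigma^\omega$, i.e. the measure on the $\sigma$-algebra generated by the cylinder sets with $\mathrm{Pr}\{w : a_1\cdots a_n \text{ is a prefix of } w\} = |\Sigma|^{-n}$ for all $a_1,\dots,a_n\in\Sigma$. Let $\mathcal{A}=(Q,\Sigma,\delta,Q_0,F)$ be a nondeterministic Büchi automaton with finite state set $Q$, transition function $\delta: Q\times\Sigma\to 2^Q$ (extended as usual to sets of states and finite words), initial states $Q_0\subseteq Q$ and final states $F\subseteq Q$. Its language $\mathcal{L}_\omega(\mathcal{A})$ is the set of all $w=a_1a_2a_3\cdots\in\Sigma^\omega$ for which there is a run $q_0q_1q_2\cdots$ with $q_0\in Q_0$, $q_{i+1}\in\delta(q_i,a_{i+1})$ for all $i\ge 0$, and $q_i\in F$ for infinitely many $i$. Assume that $\mathcal{A}$ is strongly connected (for all $p,q\in Q$ there is $x\in\Sigma^*$ with $q\in\delta(p,x)$) and that $F\neq\varnothing$. Then the two sets below are measurable (the first with respect to the completion of $\mathrm{Pr}$) and $$ \mathrm{Pr}(\mathcal{L}_\omega(\mathcal{A}))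 \;=\; 1-\mathrm{Pr}\bigl\{\,w\in\Sigma^\omega : w \text{ has a finite prefix } x \text{ with } \delta(Q_0,x)=\varnothing\,\bigr\}. $$ In particular, $\mathcal{A}$ is almost universal, i.e. $\mathrm{Pr}(\mathcal{L}_\omega(\mathcal{A}))=1$, if and only if $\delta(Q_0,x)\neq\varnothing$ for all finite words $x\in\Sigma^*$. -/

import Mathlib

open MeasureTheory Filter

/-- The uniform probability measure on the infinite words over a finite nonempty alphabet: the
letters are independent and uniformly distributed. -/
noncomputable def uniformWordMeasure (α : Type*) [Fintype α] [Nonempty α] [MeasurableSpace α] :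
    Measure (ℕ → α) :=
  Measure.infinitePi fun _ : ℕ => (PMF.uniformOfFintype α).toMeasure

/-- The finite word `x` is a prefix (possibly empty) of the infinite word `w`. -/
def IsFinitePrefix {α : Type*} (x : List α) (w : ℕ → α) : Prop :=
  ∃ n : ℕ, x = (List.range n).map w

/-- A nondeterministic Büchi automaton has the same syntax as a nondeterministic finite automaton:
a transition function `step : σ → α → Set σ`, a set `start` of initial states and a set `accept`
of final states. The transition function extended to sets of states and finite words is
`NFA.evalFrom`. -/
abbrev NBA (α σ : Type*) := NFA α σ

namespace NBA

/-- `ρ` is a run of `A` for the infinite word `w`. -/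
def IsRun {α σ : Type*} (A : NBA α σ) (w : ℕ → α) (ρ : ℕ → σ) : Prop :=
  ρ 0 ∈ A.start ∧ ∀ i, ρ (i + 1) ∈ A.step (ρ i) (w i)

/-- The accepted language of infinite words: some run visits the final states infinitely often. -/
def omegaLanguage {α σ : Type*} (A : NBA α σ) : Set (ℕ → α) :=
  {w | ∃ ρ, A.IsRun w ρ ∧ ∃ᶠ i in atTop, ρ i ∈ A.accept}

/-- Every state is reachable from every state by some finite word. -/
def StronglyConnected {α σ : Type*} (A : NBA α σ) : Prop :=
  ∀ p q : σ, ∃ x : List α, q ∈ A.evalFrom {p} x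

/-- The infinite words that have a finite prefix on which the automaton gets stuck, that is,
after which no state is reached from the initial states. -/
def blockedWords {α σ : Type*} (A : NBA α σ) : Set (ℕ → α) :=
  {w | ∃ x : List α, IsFinitePrefix x w ∧ A.evalFrom A.start x = ∅}

/-- The accepted language has probability one. -/
def AlmostUniversal {α σ : Type*} [Fintype α] [Nonempty α] [MeasurableSpace α]
    (A : NBA α σ) : Prop :=
  (uniformWordMeasure α).real A.omegaLanguage = 1

end NBA

/-! A run witnesses that no prefix blocks, so accepted words are never blocked; the converse holds
almost surely. Finiteness of the state set and strong connectivity yield one nonempty word `x` on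
which every state set either dies or passes, along paths through a final state, to a set that no
word can kill (`exists_forall_evalFrom_eq_empty_or_live`). Almost every `w` contains `x` infinitely
often (`ae_frequently_wordSegment_eq`). If such a `w` is not blocked, cutting it after occurrences
of `x` gives factors that are each crossed through a final state, and compactness
(`mem_omegaLanguage_of_forall_visitEval`) assembles an accepting run. -/

/-- The factor of length `n` of the infinite word `w` that starts at position `t`. -/
def wordSegment {α : Type*} (w : ℕ → α) (t n : ℕ) : List α :=
  (List.range n).map fun i => w (t + i)

section WordSegment

variable {α : Type*} (w : ℕ → α)

@[simp]
theorem length_wordSegment (t n : ℕ) : (wordSegment w t n).length = n := by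
  simp [wordSegment]

theorem wordSegment_add (t m n : ℕ) :
    wordSegment w t (m + n) = wordSegment w t m ++ wordSegment w (t + m) n := by
  simp [wordSegment, List.range_add, Function.comp_def, add_assoc]

theorem wordSegment_succ (t n : ℕ) :
    wordSegment w t (n + 1) = wordSegment w t n ++ [w (t + n)] := by
  simp [wordSegment, List.range_succ]

theorem wordSegment_eq_iff (t : ℕ) (x : List α) :
    wordSegment w t x.length = x ↔ ∀ i : Fin x.length, w (t + i) = x[i] := by
  constructor
  · intro h i
    have := List.getElem_of_eq h (i := i) (by simp)
    simpa [wordSegment] using this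
  · intro h
    refine List.ext_getElem (by simp) fun i h₁ h₂ => ?_
    simpa [wordSegment] using h ⟨i, h₂⟩

theorem isFinitePrefix_iff (x : List α) :
    IsFinitePrefix x w ↔ wordSegment w 0 x.length = x := by
  constructor
  · rintro ⟨n, rfl⟩
    simp [wordSegment]
  · intro h
    exact ⟨x.length, by simpa [wordSegment] using h.symm⟩

theorem measurableSet_wordSegment_eq [MeasurableSpace α] [MeasurableSingletonClass α] (t : ℕ) (x : List α) :
    MeasurableSet {w : ℕ → α | wordSegment w t x.length = x} := by
  simp only [wordSegment_eq_iff, Set.ofPred_forall]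
  exact MeasurableSet.iInter fun i =>
    (measurableSet_singleton x[i]).preimage (measurable_pi_apply (t + (i : ℕ)))

end WordSegment

/-! ### Random words: recurrence of factors, positivity of cylinders. -/

section UniformWordMeasure

variable {α : Type*} [Fintype α] [Nonempty α] [MeasurableSpace α]

instance : IsProbabilityMeasure (uniformWordMeasure α) := by
  unfold uniformWordMeasure
  infer_instance

theorem toMeasure_uniformOfFintype_singleton_pos [MeasurableSingletonClass α] (a : α) :
    0 < (PMF.uniformOfFintype α).toMeasure {a} := by
  rw [PMF.toMeasure_apply_singleton _ _ (measurableSet_singleton a)]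
  simp

/-- In a product of countably many copies of a probability space, an atom occurs infinitely often
almost surely. -/
theorem ae_frequently_eq_of_infinitePi {β : Type*} [MeasurableSpace β] [MeasurableSingletonClass β]
    (ν : Measure β) [IsProbabilityMeasure ν] (b : β) (hb : 0 < ν {b}) :
    ∀ᵐ y ∂(Measure.infinitePi fun _ : ℕ => ν), ∃ᶠ k in atTop, y k = b := by
  set P := Measure.infinitePi fun _ : ℕ => ν
  let E : ℕ → Set (ℕ → β) := fun k => {y | y k = b}
  have hE : ∀ k, MeasurableSet (E k) := fun k =>
    (measurableSet_singleton b).preimage (measurable_pi_apply k)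
  have hPE : ∀ s : Finset ℕ, P (⋂ k ∈ s, E k) = ∏ k ∈ s, ν {b} := by
    intro s
    rw [← Measure.infinitePi_pi (fun _ : ℕ => ν) (s := s) (t := fun _ => {b})
      fun _ _ => measurableSet_singleton b]
    congr 1
    ext y
    simp [E, Set.mem_pi]
  have hP1 : ∀ k, P (E k) = ν {b} := fun k => by simpa using hPE {k}
  have hind : ProbabilityTheory.iIndepSet E P := by
    rw [ProbabilityTheory.iIndepSet_iff_meas_biInter hE]
    intro s
    rw [hPE]
    simp [hP1]
  have hsum : ∑' k, P (E k) = ⊤ := by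
    simp only [hP1]
    exact ENNReal.tsum_const_eq_top_of_ne_zero hb.ne'
  -- Second Borel–Cantelli lemma: independent events with divergent sum.
  have h1 := ProbabilityTheory.measure_limsup_eq_one hE hind hsum
  have h2 : ∀ᵐ y ∂P, y ∈ limsup E atTop :=
    (prob_compl_eq_zero_iff (MeasurableSet.measurableSet_limsup hE)).2 h1
  filter_upwards [h2] with y hy
  have hfreq : ∃ᶠ k in atTop, y ∈ E k := mem_limsup_iff_frequently_mem.1 hy
  exact hfreq

/-- Consecutive blocks of length `n = x.length` are independent and identically distributed, and `x`
is an atom of their law. Occurrences at multiples of `n` already suffice. -/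
theorem ae_frequently_wordSegment_eq [MeasurableSingletonClass α] (x : List α) (hx : x ≠ []) :
    ∀ᵐ w ∂uniformWordMeasure α, ∃ᶠ t in atTop, wordSegment w t x.length = x := by
  set n := x.length with hn
  have hn0 : 0 < n := List.length_pos_of_ne_nil hx
  set μ := (PMF.uniformOfFintype α).toMeasure
  have hinj : Function.Injective fun p : ℕ × Fin n => p.1 * n + (p.2 : ℕ) := by
    rintro ⟨k, i⟩ ⟨l, j⟩ h
    have h₁ := congrArg (· / n) h
    have h₂ := congrArg (· % n) h
    simp only [Nat.mul_add_mod_of_lt i.2, Nat.mul_add_mod_of_lt j.2] at h₂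
    simp only [mul_comm _ n, Nat.mul_add_div hn0, Nat.div_eq_of_lt i.2, Nat.div_eq_of_lt j.2,
      add_zero] at h₁
    exact Prod.ext h₁ (Fin.ext h₂)
  have hmap : (uniformWordMeasure α).map (fun w (k : ℕ) (i : Fin n) => w (k * n + i)) =
      Measure.infinitePi fun _ : ℕ => Measure.infinitePi fun _ : Fin n => μ := by
    rw [← Measure.infinitePi_map_curry (fun (_ : ℕ) (_ : Fin n) => μ),
      ← Measure.map_infinitePi_infinitePi_of_inj (P := fun _ : ℕ => μ) hinj,
      Measure.map_map (by fun_prop) (by fun_prop)]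
    rfl
  let v : Fin n → α := fun i => x[i]
  have hb : 0 < Measure.infinitePi (fun _ : Fin n => μ) {v} := by
    rw [Measure.infinitePi_singleton_of_fintype]
    exact CanonicallyOrderedAdd.prod_pos.2 fun i _ => toMeasure_uniformOfFintype_singleton_pos _
  have h := ae_frequently_eq_of_infinitePi _ _ hb
  rw [← hmap] at h
  filter_upwards [ae_of_ae_map (Measurable.aemeasurable (by fun_prop)) h] with w hw
  rw [frequently_atTop] at hw ⊢
  intro a
  obtain ⟨k, hk, hkx⟩ := hw a
  refine ⟨k * n, hk.trans (Nat.le_mul_of_pos_right k hn0), ?_⟩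
  exact (wordSegment_eq_iff w _ x).2 fun i => congrFun hkx i

theorem uniformWordMeasure_isFinitePrefix_pos [MeasurableSingletonClass α] (x : List α) :
    0 < uniformWordMeasure α {w | IsFinitePrefix x w} := by
  have h : {w : ℕ → α | IsFinitePrefix x w} = Set.pi (Finset.range x.length : Set ℕ)
      fun i => {a | ∀ h : i < x.length, a = x[i]} := by
    ext w
    simp only [Set.mem_ofPred_eq, isFinitePrefix_iff, wordSegment_eq_iff, Set.mem_pi,
      Finset.coe_range, Set.mem_Iio, zero_add]
    exact ⟨fun H i _ h => H ⟨i, h⟩, fun H i => H i i.2 i.2⟩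
  rw [h, uniformWordMeasure, Measure.infinitePi_pi _ fun i _ => (Set.toFinite _).measurableSet]
  refine CanonicallyOrderedAdd.prod_pos.2 fun i hi => ?_
  have hi' : i < x.length := Finset.mem_range.1 hi
  refine (toMeasure_uniformOfFintype_singleton_pos x[i]).trans_le (measure_mono ?_)
  rintro _ rfl _
  rfl

end UniformWordMeasure

/-! ### Live sets and the universal word. -/

namespace NBA

variable {α σ : Type*} (A : NBA α σ)

theorem evalFrom_mono {S T : Set σ} (h : S ⊆ T) (x : List α) :
    A.evalFrom S x ⊆ A.evalFrom T x := by
  intro s hs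
  rw [NFA.mem_evalFrom_iff_exists] at hs ⊢
  obtain ⟨t, ht, hs⟩ := hs
  exact ⟨t, h ht, hs⟩

theorem evalFrom_empty (x : List α) : A.evalFrom ∅ x = ∅ := by
  ext s
  rw [NFA.mem_evalFrom_iff_exists]
  simp

/-- The states that are reached from `S` by reading `x` along a path that visits a final state. -/
def visitEval (S : Set σ) (x : List α) : Set σ :=
  {t | ∃ u v, x = u ++ v ∧ t ∈ A.evalFrom (A.evalFrom S u ∩ A.accept) v}

/-- No finite word leads from `S` to the empty set of states. -/
def Live (S : Set σ) : Prop :=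
  ∀ x : List α, (A.evalFrom S x).Nonempty

variable {A}

theorem Live.mono {S T : Set σ} (hS : A.Live S) (h : S ⊆ T) : A.Live T :=
  fun x => (hS x).mono (A.evalFrom_mono h x)

theorem Live.evalFrom {S : Set σ} (hS : A.Live S) (x : List α) : A.Live (A.evalFrom S x) := by
  intro y
  rw [← NFA.evalFrom_append]
  exact hS _

theorem Live.nonempty {S : Set σ} (hS : A.Live S) : S.Nonempty := hS []

theorem evalFrom_visitEval_subset (S : Set σ) (x y : List α) :
    A.evalFrom (A.visitEval S x) y ⊆ A.visitEval S (x ++ y) := by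
  intro t ht
  rw [NFA.mem_evalFrom_iff_exists] at ht
  obtain ⟨s, ⟨u, v, rfl, hs⟩, ht⟩ := ht
  refine ⟨u, v ++ y, by simp, ?_⟩
  rw [NFA.evalFrom_append]
  exact A.evalFrom_mono (Set.singleton_subset_iff.2 hs) y ht

theorem visitEval_evalFrom_subset (S : Set σ) (x y : List α) :
    A.visitEval (A.evalFrom S x) y ⊆ A.visitEval S (x ++ y) := by
  rintro t ⟨u, v, rfl, ht⟩
  refine ⟨x ++ u, v, by simp, ?_⟩
  rwa [NFA.evalFrom_append]

theorem StronglyConnected.exists_mem_visitEval (hA : A.StronglyConnected)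
    (hF : A.accept.Nonempty) {S : Set σ} {q : σ} (hq : q ∈ S) :
    ∃ u, q ∈ A.visitEval S u := by
  obtain ⟨f, hf⟩ := hF
  obtain ⟨x, hx⟩ := hA q f
  obtain ⟨y, hy⟩ := hA f q
  refine ⟨x ++ y, x, y, rfl, A.evalFrom_mono ?_ y hy⟩
  exact Set.singleton_subset_iff.2 ⟨A.evalFrom_mono (Set.singleton_subset_iff.2 hq) x hx, hf⟩

/-- From a live set of states, some word leads to a live set along paths that visit a final state:
in a minimal live subset, return to some state `q` through a final state, then read a word on which
all other states get stuck. -/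
theorem Live.exists_live_visitEval [Finite σ] (hA : A.StronglyConnected)
    (hF : A.accept.Nonempty) {S : Set σ} (hS : A.Live S) :
    ∃ x, A.Live (A.visitEval S x) := by
  obtain ⟨T, hTS, hT⟩ := (Set.toFinite {T : Set σ | A.Live T}).exists_le_minimal hS
  obtain ⟨q, hq⟩ := Live.nonempty hT.prop
  have hdiff : ¬ A.Live (T \ {q}) := fun h => (hT.le_of_le h Set.sdiff_subset hq).2 rfl
  obtain ⟨z, hz⟩ : ∃ z, A.evalFrom (T \ {q}) z = ∅ := by
    simpa [Live, Set.not_nonempty_iff_eq_empty] using hdiff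
  obtain ⟨u, hu⟩ := hA.exists_mem_visitEval hF (hTS hq)
  refine ⟨u ++ z, Live.mono ?_ (evalFrom_visitEval_subset S u z)⟩
  refine Live.mono ?_ (A.evalFrom_mono (Set.singleton_subset_iff.2 hu) z)
  -- The rest of `T` dies on `z`, so `q` alone accounts for everything `T` reaches.
  have hqz : A.evalFrom {q} z = A.evalFrom T z := by
    conv_rhs => rw [← Set.sdiff_union_of_subset (Set.singleton_subset_iff.2 hq),
      NFA.evalFrom_union, hz, Set.empty_union]
  rw [hqz]
  exact Live.evalFrom hT.prop z

/-- There is one nonempty word on which every set of states gets stuck or is led to a live set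
along paths that visit a final state. -/
theorem exists_forall_evalFrom_eq_empty_or_live [Finite σ] [Nonempty α]
    (hA : A.StronglyConnected) (hF : A.accept.Nonempty) :
    ∃ x : List α, x ≠ [] ∧ ∀ S, A.evalFrom S x = ∅ ∨ A.Live (A.visitEval S x) := by
  -- Both alternatives persist when the word is extended, so the state sets can be treated one at a
  -- time.
  have hext : ∀ {S x} (y : List α), (A.evalFrom S x = ∅ ∨ A.Live (A.visitEval S x)) →
      A.evalFrom S (x ++ y) = ∅ ∨ A.Live (A.visitEval S (x ++ y)) := by
    rintro S x y (h | h)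
    · left
      rw [NFA.evalFrom_append, h, evalFrom_empty]
    · right
      exact (h.evalFrom y).mono (evalFrom_visitEval_subset S x y)
  have hsingle : ∀ S, ∃ x : List α, A.evalFrom S x = ∅ ∨ A.Live (A.visitEval S x) := by
    intro S
    by_cases hS : A.Live S
    · obtain ⟨x, hx⟩ := hS.exists_live_visitEval hA hF
      exact ⟨x, Or.inr hx⟩
    · obtain ⟨x, hx⟩ : ∃ x, A.evalFrom S x = ∅ := by
        simpa [Live, Set.not_nonempty_iff_eq_empty] using hS
      exact ⟨x, Or.inl hx⟩
  have hfin : ∀ C : Set (Set σ), C.Finite → ∃ x : List α, x ≠ [] ∧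
      ∀ S ∈ C, A.evalFrom S x = ∅ ∨ A.Live (A.visitEval S x) := by
    intro C hC
    induction C, hC using Set.Finite.induction_on with
    | empty => exact ⟨[Classical.arbitrary α], by simp, by simp⟩
    | @insert S C _ _ ih =>
      obtain ⟨x, hx0, hx⟩ := ih
      obtain ⟨y, hy⟩ := hsingle (A.evalFrom S x)
      refine ⟨x ++ y, by simp [hx0], ?_⟩
      rintro T (rfl | hT)
      · rw [NFA.evalFrom_append]
        exact hy.imp_right fun h => h.mono (visitEval_evalFrom_subset T x y)
      · exact hext y (hx T hT)
  obtain ⟨x, hx0, hx⟩ := hfin Set.univ (Set.toFinite _)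
  exact ⟨x, hx0, fun S => hx S (Set.mem_univ S)⟩

/-! ### From factors to an accepting run. -/

/-- A finite path of `A` can be appended to a given sequence of states. -/
theorem exists_path_of_mem_evalFrom (w : ℕ → α) (ρ : ℕ → σ) (t n : ℕ) {q : σ}
    (hq : q ∈ A.evalFrom {ρ t} (wordSegment w t n)) :
    ∃ ρ' : ℕ → σ, (∀ i ≤ t, ρ' i = ρ i) ∧ ρ' (t + n) = q ∧
      ∀ i, t ≤ i → i < t + n → ρ' (i + 1) ∈ A.step (ρ' i) (w i) := by
  induction n generalizing q with
  | zero =>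
    refine ⟨ρ, fun _ _ => rfl, ?_, fun i h₁ h₂ => by omega⟩
    simpa [wordSegment, eq_comm] using hq
  | succ n ih =>
    rw [wordSegment_succ, NFA.evalFrom_append, NFA.evalFrom_singleton, NFA.mem_stepSet] at hq
    obtain ⟨p, hp, hpq⟩ := hq
    obtain ⟨ρ', h₁, h₂, h₃⟩ := ih hp
    refine ⟨Function.update ρ' (t + n + 1) q, fun i hi => ?_, ?_, fun i hi₁ hi₂ => ?_⟩
    · rw [Function.update_of_ne (by omega), h₁ i hi]
    · rw [← add_assoc, Function.update_self]
    · rw [Function.update_of_ne (show i ≠ t + n + 1 by omega)]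
      rcases (show i < t + n ∨ i = t + n by omega) with hi | rfl
      · rw [Function.update_of_ne (by omega)]
        exact h₃ i hi₁ hi
      · rwa [Function.update_self, h₂]

/-- A finite path of `A` that visits a final state can be appended to a given sequence of
states. -/
theorem exists_path_of_mem_visitEval (w : ℕ → α) (ρ : ℕ → σ) (t n : ℕ) {q : σ}
    (hq : q ∈ A.visitEval {ρ t} (wordSegment w t n)) :
    ∃ ρ' : ℕ → σ, (∀ i ≤ t, ρ' i = ρ i) ∧ ρ' (t + n) = q ∧
      (∀ i, t ≤ i → i < t + n → ρ' (i + 1) ∈ A.step (ρ' i) (w i)) ∧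
      ∃ i, t ≤ i ∧ i ≤ t + n ∧ ρ' i ∈ A.accept := by
  obtain ⟨u, v, huv, hq⟩ := hq
  have hlen : n = u.length + v.length := by simpa using congrArg List.length huv
  subst hlen
  rw [wordSegment_add] at huv
  obtain ⟨hu, hv⟩ := List.append_inj huv (by simp)
  rw [NFA.mem_evalFrom_iff_exists] at hq
  obtain ⟨f, ⟨hf, hfa⟩, hq⟩ := hq
  rw [← hu] at hf
  obtain ⟨ρ₁, h₁, h₂, h₃⟩ := exists_path_of_mem_evalFrom w ρ t _ hf
  rw [← hv, ← h₂] at hq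
  obtain ⟨ρ₂, k₁, k₂, k₃⟩ := exists_path_of_mem_evalFrom w ρ₁ _ _ hq
  refine ⟨ρ₂, fun i hi => ?_, by rw [← add_assoc, k₂], fun i hi₁ hi₂ => ?_,
    t + u.length, by omega, by omega, ?_⟩
  · rw [k₁ i (by omega), h₁ i hi]
  · rcases lt_or_ge i (t + u.length) with hi | hi
    · rw [k₁ _ (by omega), k₁ _ (by omega)]
      exact h₃ i hi₁ hi
    · exact k₃ i hi (by omega)
  · rwa [k₁ _ le_rfl, h₂]

theorem mem_visitEval_iff_exists {S : Set σ} {x : List α} {q : σ} :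
    q ∈ A.visitEval S x ↔ ∃ p ∈ S, q ∈ A.visitEval {p} x := by
  constructor
  · rintro ⟨u, v, rfl, hq⟩
    rw [NFA.mem_evalFrom_iff_exists] at hq
    obtain ⟨f, ⟨hf, hfa⟩, hq⟩ := hq
    rw [NFA.mem_evalFrom_iff_exists] at hf
    obtain ⟨p, hp, hf⟩ := hf
    have hsub : {f} ⊆ A.evalFrom {p} u ∩ A.accept := Set.singleton_subset_iff.2 ⟨hf, hfa⟩
    exact ⟨p, hp, u, v, rfl, A.evalFrom_mono hsub v hq⟩
  · rintro ⟨p, hp, u, v, rfl, hq⟩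
    exact ⟨u, v, rfl, A.evalFrom_mono (Set.inter_subset_inter_left _
      (A.evalFrom_mono (Set.singleton_subset_iff.2 hp) u)) v hq⟩

/-- A form of König's lemma: if `w` is cut into factors such that the sets of states reached along
paths that visit a final state in each factor are nonempty, then `w` is accepted. -/
theorem mem_omegaLanguage_of_forall_visitEval [Finite σ] (w : ℕ → α) (t : ℕ → ℕ)
    (ht0 : t 0 = 0) (ht : StrictMono t) (T : ℕ → Set σ) (hT0 : T 0 ⊆ A.start)
    (hT : ∀ k, T (k + 1) ⊆ A.visitEval (T k) (wordSegment w (t k) (t (k + 1) - t k)))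
    (hne : ∀ k, (T k).Nonempty) : w ∈ A.omegaLanguage := by
  -- Each final visit is confined to a bounded window, which makes `D k` closed; infinitely many
  -- visits alone would not be a closed condition.
  let D : ℕ → Set (ℕ → σ) := fun k => {ρ | ρ 0 ∈ A.start ∧
    (∀ i < t k, ρ (i + 1) ∈ A.step (ρ i) (w i)) ∧
    ∀ j < k, ∃ i ∈ Set.Icc (t j) (t (j + 1)), ρ i ∈ A.accept}
  have hpath : ∀ k, ∀ q ∈ T k, ∃ ρ ∈ D k, ρ (t k) = q := by
    intro k
    induction k with
    | zero =>
      intro q hq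
      exact ⟨fun _ => q, ⟨hT0 hq, by simp [ht0], by simp⟩, rfl⟩
    | succ k ih =>
      intro q hq
      obtain ⟨p, hp, hq⟩ := mem_visitEval_iff_exists.1 (hT k hq)
      obtain ⟨ρ, ⟨h₁, h₂, h₃⟩, rfl⟩ := ih p hp
      obtain ⟨ρ', k₁, k₂, k₃, i₀, hi₀, hi₀', hacc⟩ := exists_path_of_mem_visitEval w ρ _ _ hq
      have hlt : t k < t (k + 1) := ht k.lt_succ_self
      rw [Nat.add_sub_cancel' hlt.le] at k₂ k₃ hi₀'
      refine ⟨ρ', ⟨by rwa [k₁ 0 (Nat.zero_le _)], fun i hi => ?_, fun j hj => ?_⟩, k₂⟩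
      · rcases lt_or_ge i (t k) with h | h
        · rw [k₁ _ h, k₁ _ h.le]
          exact h₂ i h
        · exact k₃ i h hi
      · rcases Nat.lt_succ_iff_lt_or_eq.1 hj with h | rfl
        · obtain ⟨i, hi, hia⟩ := h₃ j h
          exact ⟨i, hi, by rwa [k₁ i (hi.2.trans (ht.monotone h))]⟩
        · exact ⟨i₀, ⟨hi₀, hi₀'⟩, hacc⟩
  -- With `σ` finite and discrete, `ℕ → σ` is compact, so the decreasing sets `D k` have a common
  -- point.
  let _ : TopologicalSpace σ := ⊥
  have : DiscreteTopology σ := ⟨rfl⟩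
  have hclosed : ∀ k, IsClosed (D k) := by
    intro k
    have hcoord : ∀ (i : ℕ) (B : Set σ), IsClosed {ρ : ℕ → σ | ρ i ∈ B} := fun i B =>
      (isClosed_discrete B).preimage (continuous_apply i)
    have hstep : ∀ i, IsClosed {ρ : ℕ → σ | ρ (i + 1) ∈ A.step (ρ i) (w i)} := fun i =>
      IsClosed.preimage (f := fun ρ : ℕ → σ => (ρ i, ρ (i + 1)))
        ((continuous_apply i).prodMk (continuous_apply (i + 1)))
        (isClosed_discrete {p : σ × σ | p.2 ∈ A.step p.1 (w i)})
    have hD : D k = {ρ | ρ 0 ∈ A.start} ∩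
        ((⋂ i < t k, {ρ | ρ (i + 1) ∈ A.step (ρ i) (w i)}) ∩
        ⋂ j < k, ⋃ i ∈ Set.Icc (t j) (t (j + 1)), {ρ | ρ i ∈ A.accept}) := by
      ext ρ
      simp [D]
    rw [hD]
    exact (hcoord 0 A.start).inter ((isClosed_biInter fun i _ => hstep i).inter
      (isClosed_biInter fun j _ => (Set.finite_Icc (t j) (t (j + 1))).isClosed_biUnion
        fun i _ => hcoord i A.accept))
  obtain ⟨ρ, hρ⟩ := IsCompact.nonempty_iInter_of_sequence_nonempty_isCompact_isClosed D
    (fun k ρ h => ⟨h.1, fun i hi => h.2.1 i (hi.trans (ht k.lt_succ_self)),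
      fun j hj => h.2.2 j (hj.trans k.lt_succ_self)⟩)
    (fun k => by
      obtain ⟨q, hq⟩ := hne k
      obtain ⟨ρ, hρ, -⟩ := hpath k q hq
      exact ⟨ρ, hρ⟩)
    (hclosed 0).isCompact hclosed
  rw [Set.mem_iInter] at hρ
  refine ⟨ρ, ⟨(hρ 0).1, fun i => (hρ (i + 1)).2.1 i (ht.le_apply (x := i + 1))⟩, ?_⟩
  rw [frequently_atTop]
  intro a
  obtain ⟨i, hi, hacc⟩ := (hρ (a + 1)).2.2 a a.lt_succ_self
  exact ⟨i, (ht.le_apply (x := a)).trans hi.1, hacc⟩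

theorem mem_omegaLanguage_of_frequently [Finite σ] {x : List α}
    (hx : ∀ S, A.evalFrom S x = ∅ ∨ A.Live (A.visitEval S x)) {w : ℕ → α}
    (hw : ∃ᶠ t in atTop, wordSegment w t x.length = x) (hB : w ∉ A.blockedWords) :
    w ∈ A.omegaLanguage := by
  -- A position and a state set that never gets stuck on the rest of `w`.
  let Good : ℕ × Set σ → Prop := fun p => ∀ n, (A.evalFrom p.2 (wordSegment w p.1 n)).Nonempty
  have hstep : ∀ p : {p // Good p}, ∃ q : {p // Good p}, p.1.1 < q.1.1 ∧
      q.1.2 = A.visitEval p.1.2 (wordSegment w p.1.1 (q.1.1 - p.1.1)) := by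
    rintro ⟨⟨t, S⟩, hp⟩
    -- Starting at `t + 1` or later makes the cut positions strictly increase, even for empty `x`.
    obtain ⟨s, hs, hsx⟩ := frequently_atTop.1 hw (t + 1)
    obtain ⟨m, rfl⟩ := Nat.exists_eq_add_of_le (show t ≤ s by omega)
    have heq : wordSegment w t (m + x.length) = wordSegment w t m ++ x := by
      rw [wordSegment_add, hsx]
    have hne := hp (m + x.length)
    dsimp only at hne
    rw [heq, NFA.evalFrom_append] at hne
    have hlive : A.Live (A.visitEval S (wordSegment w t (m + x.length))) := by
      rw [heq]
      exact ((hx _).resolve_left hne.ne_empty).mono (visitEval_evalFrom_subset S _ x)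
    refine ⟨⟨(t + (m + x.length), A.visitEval S (wordSegment w t (m + x.length))),
      fun n => hlive _⟩, ?_, ?_⟩
    · show t < t + (m + x.length)
      omega
    · show _ = A.visitEval S (wordSegment w t (t + (m + x.length) - t))
      rw [Nat.add_sub_cancel_left]
  choose next hnext using hstep
  have hstart : Good (0, A.start) := by
    intro n
    rw [Set.nonempty_iff_ne_empty]
    intro h
    exact hB ⟨wordSegment w 0 n, ⟨n, by simp [wordSegment]⟩, h⟩
  let seq : ℕ → {p // Good p} := fun k => next^[k] ⟨(0, A.start), hstart⟩
  have hseq : ∀ k, seq (k + 1) = next (seq k) := fun k => Function.iterate_succ_apply' next k _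
  refine mem_omegaLanguage_of_forall_visitEval w (fun k => (seq k).1.1) rfl
    (strictMono_nat_of_lt_succ fun k => ?_) (fun k => (seq k).1.2) subset_rfl (fun k => ?_)
    fun k => (seq k).2 0
  · rw [hseq]
    exact (hnext (seq k)).1
  · rw [hseq]
    exact (hnext (seq k)).2.subset

theorem IsRun.mem_evalFrom {w : ℕ → α} {ρ : ℕ → σ} (h : A.IsRun w ρ) (n : ℕ) :
    ρ n ∈ A.evalFrom A.start (wordSegment w 0 n) := by
  induction n with
  | zero => exact h.1
  | succ n ih =>
    rw [wordSegment_succ, NFA.evalFrom_append, NFA.evalFrom_singleton, NFA.mem_stepSet, zero_add]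
    exact ⟨ρ n, ih, h.2 n⟩

theorem disjoint_omegaLanguage_blockedWords : Disjoint A.omegaLanguage A.blockedWords := by
  rw [Set.disjoint_left]
  rintro w ⟨ρ, hρ, -⟩ ⟨x, hx, hempty⟩
  have := hρ.mem_evalFrom x.length
  rw [(isFinitePrefix_iff w x).1 hx, hempty] at this
  exact this

/-! ### Measurability and the almost sure equality. -/

variable [Fintype α] [MeasurableSpace α] [MeasurableSingletonClass α]

theorem measurableSet_blockedWords : MeasurableSet A.blockedWords := by
  have h : A.blockedWords = ⋃ x ∈ {x : List α | A.evalFrom A.start x = ∅},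
      {w | wordSegment w 0 x.length = x} := by
    ext w
    simp [blockedWords, isFinitePrefix_iff, and_comm]
  rw [h]
  exact MeasurableSet.biUnion (Set.to_countable _) fun x _ => measurableSet_wordSegment_eq 0 x

theorem omegaLanguage_ae_eq [Nonempty α] [Finite σ] (hA : A.StronglyConnected)
    (hF : A.accept.Nonempty) :
    A.omegaLanguage =ᵐ[uniformWordMeasure α] (A.blockedWordsᶜ : Set (ℕ → α)) := by
  obtain ⟨x, hx0, hx⟩ := exists_forall_evalFrom_eq_empty_or_live hA hF
  rw [eventuallyEq_set]
  filter_upwards [ae_frequently_wordSegment_eq x hx0] with w hw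
  exact ⟨fun h => Set.disjoint_left.1 disjoint_omegaLanguage_blockedWords h,
    fun h => mem_omegaLanguage_of_frequently hx hw h⟩

end NBA

theorem mainTheorem8 {α σ : Type*} [Fintype α] [Nonempty α] [MeasurableSpace α]
    [MeasurableSingletonClass α] [Finite σ] (A : NBA α σ)
    (hA : A.StronglyConnected) (hF : A.accept.Nonempty) :
    NullMeasurableSet A.omegaLanguage (uniformWordMeasure α) ∧
    MeasurableSet A.blockedWords ∧
    (uniformWordMeasure α).real A.omegaLanguage =
      1 - (uniformWordMeasure α).real A.blockedWords ∧
    (A.AlmostUniversal ↔ ∀ x : List α, A.evalFrom A.start x ≠ ∅) := by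
  have hae := NBA.omegaLanguage_ae_eq hA hF
  have hmeas : MeasurableSet A.blockedWords := NBA.measurableSet_blockedWords
  have hprob : (uniformWordMeasure α).real A.omegaLanguage =
      1 - (uniformWordMeasure α).real A.blockedWords := by
    rw [measureReal_congr hae, probReal_compl_eq_one_sub hmeas]
  refine ⟨hmeas.compl.nullMeasurableSet.congr hae.symm, hmeas, hprob, ?_⟩
  rw [NBA.AlmostUniversal, hprob, sub_eq_self, measureReal_eq_zero_iff]
  constructor
  · intro h x hx
    -- A blocking word would put a whole cylinder, of positive measure, inside the null set of
    -- blocked words.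
    refine (uniformWordMeasure_isFinitePrefix_pos x).ne' (measure_mono_null ?_ h)
    exact fun w hw => ⟨x, hw, hx⟩
  · intro h
    have hempty : A.blockedWords = ∅ :=
      Set.eq_empty_of_forall_notMem fun w ⟨x, _, hx⟩ => h x hx
    rw [hempty, measure_empty]
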